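/- Let $\mathfrak S_m$ be the set of permutations $\sigma=\sigma_1\cdots\sigma_m$ of $\{1,\dots,m\}$. The descent set of $\sigma$ is $D(\sigma)=\{i : 1\le i\le m-1,\ \sigma_i>\sigma_{i+1}\}$ and its major index is $\operatorname{maj}(\sigma)=\sum_{i\in D(\sigma)} i$. Call $\sigma$ alternating if $D(\sigma)$ is the set of odd elements of $\{1,\dots,m-1\}$ (that is, $\sigma_1>\sigma_2<\sigma_3>\cdots$), and reverse alternating if $D(\sigma)$ is the set of even elements of $\{1,\dots,m-1\}$ (that is, $\sigma_1<\sigma_2>\sigma_3<\cdots$). Let $E_m$ be the number of alternating permutations in $\mathfrak S_m$, and let $$E_m(q)=\sum_{\sigma\in\mathfrak S_m\text{ reverse alternating}} q^{\operatorname{maj}(\sigma^{-1})}.$$ Write $(a;q)_m=\prod_{i=0}^{m-1}(1-aq^i)$. Let $\mathcal D_n$ be the set of Dyck paths of length $2n$, i.e. paths from $(0,0)$ to $(2n,0)$ with steps $(1,1)$ and $(1,-1)$ that stay in the upper half plane. Let $h_i$ be the height that the path reaches after $i$ steps, so $h_0=h_{2n}=0$. **Theorem.** Let $n\ge 0$ be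 an integer. 1. For every field $K$ and every $q\in K$ such that $q^k\ne 1$ for $1\le k\le 2n+1$, $$\sum_{(h_0,\dots,h_{2n})\in\mathcal D_n}\ \prod_{i=0}^{2n}\frac{q^{h_i}}{1-q^{2h_i+1}}=\frac{E_{2n+1}(q)}{(q;q)_{2n+1}}.$$ In particular this holds as an identity of rational functions in an indeterminate $q$. 2. At $q=1$, one has $$\sum_{(h_0,\dots,h_{2n})\in\mathcal D_n}\frac{(2n+1)!}{\prod_{i=0}^{2n}(2h_i+1)}=E_{2n+1}.$$ -/

import Mathlib

/-- The descent set `D(σ) = {i : 1 ≤ i ≤ n - 1, σ_i > σ_{i+1}}` of a permutation of `n` letters.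
Positions are numbered from `1`, so that the one-line notation of `σ` is `σ_1 … σ_n` with `σ_i` the
value of `σ` at the element `i - 1` of `Fin n`. -/
def descentSet {n : ℕ} (σ : Equiv.Perm (Fin n)) : Finset ℕ :=
  {i ∈ Finset.Ico 1 n | ∃ a b : Fin n, (a : ℕ) + 1 = i ∧ (b : ℕ) = i ∧ σ b < σ a}

/-- The major index: the sum of the descents. -/
def majorIndex {n : ℕ} (σ : Equiv.Perm (Fin n)) : ℕ :=
  ∑ i ∈ descentSet σ, i

/-- Alternating permutations, `σ_1 > σ_2 < σ_3 > ⋯`: the descents are exactly the odd positions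
in `{1, …, n - 1}`. -/
def Alt (n : ℕ) : Finset (Equiv.Perm (Fin n)) :=
  {σ | descentSet σ = {i ∈ Finset.Ico 1 n | Odd i}}

/-- Reverse alternating permutations, `σ_1 < σ_2 > σ_3 < ⋯`: the descents are exactly the even
positions in `{1, …, n - 1}`. -/
def RevAlt (n : ℕ) : Finset (Equiv.Perm (Fin n)) :=
  {σ | descentSet σ = {i ∈ Finset.Ico 1 n | Even i}}

/-- The Euler number `E_n`, the number of alternating permutations of `n` letters. -/
def eulerNumber (n : ℕ) : ℕ := (Alt n).card

/-- The `q`-Euler number `E_n(q)`, the sum of `q ^ maj(σ⁻¹)` over reverse alternating `σ`. -/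
def qEulerNumber {K : Type*} [CommSemiring K] (n : ℕ) (q : K) : K :=
  ∑ σ ∈ RevAlt n, q ^ majorIndex σ⁻¹

/-- The `q`-Pochhammer symbol `(a; q)_n`. -/
def qPochhammer {K : Type*} [CommRing K] (a q : K) (n : ℕ) : K :=
  ∏ i ∈ Finset.range n, (1 - a * q ^ i)

/-- The height `h_i` that a Dyck path reaches after `i` steps: the number of up steps minus the
number of down steps among the first `i` steps. The subtraction never truncates, because a Dyck
path stays in the upper half plane. -/
def DyckWord.height (d : DyckWord) (i : ℕ) : ℕ :=
  (d.toList.take i).count DyckStep.U - (d.toList.take i).count DyckStep.D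

/-!
Write `[k] = 1 + q + ⋯ + q ^ (k - 1)`. With the weight `w h = q ^ h / [2 h + 1]` for a vertex at
height `h`, both parts are instances of

`∑ d, ∏ i, w (h_i) = E_{2n+1}(q) / [2n+1]!`   (`sum_prod_dyckWeight`),

valid in every field in which `[1], …, [2n+1]` do not vanish: for `q ≠ 1` powers of `1 - q` are
divided out, and `q = 1` is allowed in characteristic `0`. The two sides are compared through
generating functions, the Dyck paths being a continued fraction and the Euler numbers a
`q`-tangent.

Dyck paths: let `F h` be the generating function, in `X` per pair of steps, of the paths that start
and end at height `h` and stay there or above. The first return gives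
`F h = w h + w h * X * F (h + 1) * F h`. The series
`g h = ∑ (-X) ^ k / ([2] [4] ⋯ [2k] · [1] [3] ⋯ [2h+2k-1])` satisfy the contiguous relation
`g h = [2h+1] * g (h + 1) - q ^ (2h+1) * X * g (h + 2)`, and induction on the degree gives
`F h * g h = q ^ h * g (h + 1)` (`X_pow_dvd_dyckSeries_mul_sub`). As only `[1], …, [2n+1]` are
invertible, everything is a congruence modulo a power of `X`.

Euler numbers: `g 0` and `g 1` have coefficients `±1 / [2k]!` and `±1 / [2k+1]!`. That the
generating function of `E_{2n+1}(q) / [2n+1]!` multiplies `g 0` to `g 1`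
(`X_pow_dvd_eulerSeries_mul_sub`) is a telescoping sum over the permutations that increase on the
first `2k` positions and are reverse alternating beyond. It needs the product formula
`descentSum_mul_qFactorial`: letting the first `a` positions increase freely multiplies the
generating function of the rest by the `q`-binomial coefficient. This comes from words in the
letters `0, 1, 2, …` with prescribed ascents, for which concatenation makes the product formula
evident (`ascentSeries_mul`). Sorting a word turns it into a permutation whose inverse has the
ascents of the word as its descents, and the words with a given sorting permutation `π` have
generating function `x ^ maj(π) / ((1 - x) (1 - x ^ 2) ⋯)` (`tsum_antitoneSort_eq`). The sums over
words are taken in `ℝ≥0∞`, where no convergence question arises. The resulting identity holds at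
all `x` in `(0, 1)`, hence in `ℤ[X]` and in every commutative ring.
-/

open Finset

/-! ### `q`-integers -/

/-- The `q`-integer `[k] = 1 + q + ⋯ + q ^ (k - 1)`. -/
def qInt {R : Type*} [CommSemiring R] (q : R) (k : ℕ) : R :=
  ∑ i ∈ range k, q ^ i

/-- The `q`-factorial `[k]! = [1] [2] ⋯ [k]`. -/
def qFactorial {R : Type*} [CommSemiring R] (q : R) (k : ℕ) : R :=
  ∏ i ∈ range k, qInt q (i + 1)

lemma qInt_add {R : Type*} [CommSemiring R] (q : R) (m k : ℕ) :
    qInt q (m + k) = qInt q m + q ^ m * qInt q k := by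
  simp only [qInt, sum_range_add, pow_add, mul_sum]

lemma qFactorial_ne_zero {K : Type*} [Field K] {q : K} {N : ℕ}
    (hq : ∀ k ∈ Icc 1 N, qInt q k ≠ 0) {k : ℕ} (hk : k ≤ N) : qFactorial q k ≠ 0 := by
  refine prod_ne_zero_iff.mpr fun i hi => hq _ ?_
  simp only [mem_range, mem_Icc] at *
  omega

/-! ### Weights of Dyck paths -/

namespace BinaryTree

/-- The weight, started at height `h`, of the Dyck path that corresponds to a binary tree: the
product of `w` over the heights of all vertices of the path. The root records the decomposition of
a path as an up step, the path of the left subtree, a down step, and the path of the right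
subtree. -/
def heightWeight {R : Type*} [CommSemiring R] (w : ℕ → R) : BinaryTree Unit → ℕ → R
  | nil, h => w h
  | node _ l r, h => w h * (heightWeight w l (h + 1) * heightWeight w r h)

end BinaryTree

namespace DyckWord

lemma height_zero_right (p : DyckWord) : p.height 0 = 0 := by simp [height]

lemma height_nest_add_succ (p r : DyckWord) {i : ℕ} (hi : i ≤ 2 * p.semilength) :
    (p.nest + r).height (i + 1) = p.height i + 1 := by
  have h1 : (p.nest + r).toList = DyckStep.U :: (p.toList ++ (DyckStep.D :: r.toList)) := by
    change ([DyckStep.U] ++ p.toList ++ [DyckStep.D]) ++ r.toList = _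
    simp
  have h2 := p.count_D_le_count_U i
  rw [two_mul_semilength_eq_length] at hi
  simp only [height, h1, List.take_succ_cons, List.take_append_of_le_length hi]
  simp
  omega

lemma height_nest_add_add (p r : DyckWord) (i : ℕ) :
    (p.nest + r).height (2 * p.semilength + 1 + (i + 1)) = r.height i := by
  have h1 : (p.nest + r).toList = p.nest.toList ++ r.toList := rfl
  have h3 : 2 * p.semilength + 1 + (i + 1) = p.nest.toList.length + i := by
    rw [← two_mul_semilength_eq_length, semilength_nest]; ring
  have h4 := p.nest.count_U_eq_count_D
  simp only [height, h1, h3, List.take_length_add_append, List.count_append, h4]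
  omega

/-- The sum over all Dyck paths of semilength `n`, shifted up by `h`, of the product of `w` over
the heights of the vertices. -/
def heightSum {R : Type*} [CommSemiring R] (w : ℕ → R) (h n : ℕ) : R :=
  ∑ t ∈ BinaryTree.treesOfNumNodesEq n, t.heightWeight w h

lemma prod_height_ofTree {R : Type*} [CommSemiring R] (w : ℕ → R) (t : BinaryTree Unit) (h : ℕ) :
    ∏ i ∈ range (2 * (ofTree t).semilength + 1), w (h + (ofTree t).height i) =
      t.heightWeight w h := by
  induction t generalizing h with
  | nil => simp [ofTree, BinaryTree.heightWeight, height]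
  | node _ l r ihl ihr =>
    have h1 : 2 * ((ofTree l).nest + ofTree r).semilength + 1 =
        (2 * (ofTree l).semilength + 1) + (2 * (ofTree r).semilength + 1) + 1 := by
      rw [semilength_add, semilength_nest]; ring
    rw [ofTree, h1, prod_range_succ', prod_range_add, height_zero_right, add_zero,
      BinaryTree.heightWeight, ← ihl, ← ihr, mul_comm]
    congr 2
    · refine prod_congr rfl fun i hi => ?_
      rw [height_nest_add_succ _ _ (by simpa [Nat.lt_succ_iff] using hi)]
      congr 1; ring
    · refine prod_congr rfl fun i _ => ?_
      rw [add_assoc (2 * _ + 1), height_nest_add_add]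

lemma sum_prod_height {R : Type*} [CommSemiring R] (w : ℕ → R) (n : ℕ) :
    ∑ d : {d : DyckWord // d.semilength = n}, ∏ i ∈ range (2 * n + 1), w (d.1.height i) =
      heightSum w 0 n := by
  rw [heightSum, ← sum_coe_sort (BinaryTree.treesOfNumNodesEq n)]
  refine Fintype.sum_equiv (equivTreesOfNumNodesEq n) _ _ fun d => ?_
  have := prod_height_ofTree w d.1.toTree 0
  rw [ofTree_toTree, d.2] at this
  simpa using this

lemma heightSum_zero {R : Type*} [CommSemiring R] (w : ℕ → R) (h : ℕ) :
    heightSum w h 0 = w h := by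
  simp [heightSum, BinaryTree.heightWeight]

/-- First-return decomposition. -/
lemma heightSum_succ {R : Type*} [CommSemiring R] (w : ℕ → R) (h n : ℕ) :
    heightSum w h (n + 1) =
      w h * ∑ ij ∈ antidiagonal n, heightSum w (h + 1) ij.1 * heightSum w h ij.2 := by
  rw [heightSum, BinaryTree.treesOfNumNodesEq_succ, sum_biUnion]
  · rw [mul_sum]
    refine sum_congr rfl fun ij _ => ?_
    rw [BinaryTree.pairwiseNode, sum_map, sum_product, heightSum, heightSum, sum_mul_sum, mul_sum]
    simp only [mul_sum]
    rfl
  · intro x _ y _ hxy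
    rw [Function.onFun, Finset.disjoint_left]
    simp only [BinaryTree.pairwiseNode, mem_map, mem_product, BinaryTree.mem_treesOfNumNodesEq]
    rintro _ ⟨a, ⟨h1, h2⟩, rfl⟩ ⟨b, ⟨h3, h4⟩, hb⟩
    obtain rfl : b = a := by simpa using hb
    exact hxy (Prod.ext (h1.symm.trans h3) (h2.symm.trans h4))

end DyckWord

/-! ### The continued fraction of Dyck paths -/

section ContinuedFraction

open PowerSeries DyckWord

variable {K : Type*} [Field K]

/-- The weight `q ^ h / [2 h + 1]` of a vertex at height `h`. -/
def dyckWeight (q : K) (h : ℕ) : K := q ^ h / qInt q (2 * h + 1)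

/-- The generating function of Dyck paths that start and end at height `h` and stay there or above,
with one `X` for each pair of steps. Its coefficient of `X ^ m` involves the heights from `h`
to `h + m`, and is used only where `[2 h + 1], [2 h + 3], …, [2 (h + m) + 1]` do not vanish. -/
def dyckSeries (q : K) (h : ℕ) : PowerSeries K := PowerSeries.mk (heightSum (dyckWeight q) h)

/-- The denominator `[2] [4] ⋯ [2 k] · [1] [3] ⋯ [2 (h + k) - 1]` of a coefficient of
`besselSeries`. -/
def besselDenom (q : K) (h k : ℕ) : K :=
  (∏ i ∈ range k, qInt q (2 * i + 2)) * ∏ i ∈ range (h + k), qInt q (2 * i + 1)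

/-- A `q`-analogue of the Bessel function of order `h - 1 / 2`, up to a power of the variable and
with `X` for the square of the variable. For `h = 0` and `h = 1` it is a `q`-cosine and a
`q`-sine. Coefficients whose denominator vanishes are `0` by the convention for division; only
those with nonzero denominators are used. -/
def besselSeries (q : K) (h : ℕ) : PowerSeries K :=
  PowerSeries.mk fun k => (-1) ^ k / besselDenom q h k

/-- The first-return decomposition as one level of a continued fraction. -/
lemma dyckSeries_eq (q : K) (h : ℕ) :
    dyckSeries q h = C (dyckWeight q h) +
      X * (C (dyckWeight q h) * (dyckSeries q (h + 1) * dyckSeries q h)) := by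
  ext n
  cases n with
  | zero => simp [dyckSeries, heightSum_zero]
  | succ n =>
    rw [map_add, coeff_succ_X_mul, coeff_C_mul, PowerSeries.coeff_mul]
    simp [dyckSeries, heightSum_succ]

lemma besselDenom_ne_zero {q : K} {N : ℕ} (hq : ∀ k ∈ Icc 1 (2 * N + 1), qInt q k ≠ 0) {h k : ℕ}
    (hk : k ≤ N) (hh : h + k ≤ N + 1) : besselDenom q h k ≠ 0 := by
  refine mul_ne_zero (prod_ne_zero_iff.mpr fun i hi => hq _ ?_)
    (prod_ne_zero_iff.mpr fun i hi => hq _ ?_) <;>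
  · simp only [mem_range, mem_Icc] at *
    omega

lemma besselDenom_zero_left (q : K) (k : ℕ) : besselDenom q 0 k = qFactorial q (2 * k) := by
  induction k with
  | zero => simp [besselDenom, qFactorial]
  | succ k ih =>
    simp only [besselDenom, qFactorial, zero_add, prod_range_succ, mul_add, mul_one] at *
    rw [← ih]; ring

lemma besselDenom_one_left (q : K) (k : ℕ) : besselDenom q 1 k = qFactorial q (2 * k + 1) := by
  have := besselDenom_zero_left q k
  simp only [besselDenom, qFactorial, zero_add, prod_range_succ, add_comm 1] at *
  rw [← this]; ring

/-- The contiguous relation between `q`-Bessel functions. It holds in all degrees in which no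
denominator vanishes. -/
lemma X_pow_dvd_besselSeries_sub {q : K} {N : ℕ} (hq : ∀ k ∈ Icc 1 (2 * N + 1), qInt q k ≠ 0)
    {h m : ℕ} (hm : h + m ≤ N) :
    X ^ (m + 1) ∣ besselSeries q h - (C (qInt q (2 * h + 1)) * besselSeries q (h + 1) -
      X * (C (q ^ (2 * h + 1)) * besselSeries q (h + 2))) := by
  rw [X_pow_dvd_iff]
  intro k hk
  have hodd : qInt q (2 * (h + k) + 1) ≠ 0 := hq _ (by simp only [mem_Icc]; omega)
  cases k with
  | zero =>
    -- `[2 h + 1]` is the one factor by which the two denominators differ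
    have h0 := besselDenom_ne_zero hq (h := h) (k := 0) (by omega) (by omega)
    have h1 : besselDenom q (h + 1) 0 = besselDenom q h 0 * qInt q (2 * h + 1) := by
      simp [besselDenom, prod_range_succ]
    simp only [add_zero] at hodd
    simp only [map_sub, coeff_zero_X_mul, coeff_C_mul, besselSeries, coeff_mk, h1]
    field_simp
    ring
  | succ k =>
    -- over a common denominator the relation is
    -- `[2 (h + k + 1) + 1] = [2 h + 1] + q ^ (2 h + 1) * [2 k + 2]`
    have h0 := besselDenom_ne_zero hq (h := h) (k := k + 1) (by omega) (by omega)
    have heven : qInt q (2 * k + 2) ≠ 0 := hq _ (by simp only [mem_Icc]; omega)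
    have h1 : besselDenom q (h + 1) (k + 1) =
        besselDenom q h (k + 1) * qInt q (2 * (h + (k + 1)) + 1) := by
      rw [besselDenom, besselDenom, add_right_comm, prod_range_succ _ (h + (k + 1)), mul_assoc]
    have h2 : besselDenom q h (k + 1) * qInt q (2 * (h + (k + 1)) + 1) =
        besselDenom q (h + 2) k * qInt q (2 * k + 2) := by
      rw [← h1, besselDenom, besselDenom, prod_range_succ,
        show h + 1 + (k + 1) = h + 2 + k by ring]
      ring
    have h3 : besselDenom q (h + 2) k =
        besselDenom q h (k + 1) * qInt q (2 * (h + (k + 1)) + 1) / qInt q (2 * k + 2) := by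
      rw [h2, mul_div_cancel_right₀ _ heven]
    have h4 : qInt q (2 * (h + (k + 1)) + 1) =
        qInt q (2 * h + 1) + q ^ (2 * h + 1) * qInt q (2 * k + 2) := by
      rw [← qInt_add]; congr 1; ring
    simp only [map_sub, coeff_succ_X_mul, coeff_C_mul, besselSeries, coeff_mk, h1, h3]
    field_simp
    rw [h4]
    ring

/-- The quotient of two consecutive `q`-Bessel functions has the continued fraction expansion that
enumerates Dyck paths. -/
lemma X_pow_dvd_dyckSeries_mul_sub {q : K} {N : ℕ}
    (hq : ∀ k ∈ Icc 1 (2 * N + 1), qInt q k ≠ 0) {h m : ℕ} (hm : h + m ≤ N + 1) :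
    X ^ m ∣ dyckSeries q h * besselSeries q h - C (q ^ h) * besselSeries q (h + 1) := by
  induction m generalizing h with
  | zero => simp
  | succ m ih =>
    -- the error terms `δ` and `ε` of the two congruences, and the error they produce
    obtain ⟨δ, hδ⟩ := ih (h := h + 1) (by omega)
    obtain ⟨ε, hε⟩ := X_pow_dvd_besselSeries_sub hq (h := h) (m := m) (by omega)
    have hodd : qInt q (2 * h + 1) ≠ 0 := hq _ (by simp only [mem_Icc]; omega)
    have hw : C (dyckWeight q h) * C (qInt q (2 * h + 1)) = C (q ^ h) := by
      rw [← map_mul, dyckWeight, div_mul_cancel₀ _ hodd]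
    have hp : C (q ^ (2 * h + 1)) = C (q ^ h) * C (q ^ (h + 1)) := by
      rw [← map_mul, ← pow_add]; congr 2; ring
    have hF := dyckSeries_eq q h
    rw [hp] at hε
    refine ⟨C (q ^ h) * dyckSeries q h * δ + dyckSeries q h * ε, ?_⟩
    linear_combination (dyckSeries q h) * hε + (X * C (q ^ h) * dyckSeries q h) * hδ +
      (C (qInt q (2 * h + 1)) * besselSeries q (h + 1)) * hF +
      (besselSeries q (h + 1) + X * dyckSeries q (h+1) * dyckSeries q h * besselSeries q (h+1)) * hw

end ContinuedFraction

/-! ### Words with prescribed ascents -/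

section PPartition

open ENNReal

/-- The ascent set of a word, numbered as `descentSet` is. -/
def ascentSet {n : ℕ} (f : Fin n → ℕ) : Finset ℕ :=
  {i ∈ Ico 1 n | ∃ a b : Fin n, (a : ℕ) + 1 = i ∧ (b : ℕ) = i ∧ f a < f b}

/-- The sum of `q ^ maj(σ⁻¹)` over the permutations `σ` with descent set `S`. -/
def descentSum {R : Type*} [CommSemiring R] (n : ℕ) (S : Finset ℕ) (q : R) : R :=
  ∑ σ : Equiv.Perm (Fin n) with descentSet σ = S, q ^ majorIndex σ⁻¹

/-- The generating function, by sum of letters, of the words of length `n` in the letters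
`0, 1, 2, …` with ascent set `S`. -/
noncomputable def ascentSeries (n : ℕ) (S : Finset ℕ) (x : ℝ≥0∞) : ℝ≥0∞ :=
  ∑' f : Fin n → ℕ, if ascentSet f = S then x ^ ∑ i, f i else 0

/-- The permutation that sorts a word into weakly decreasing order, equal letters from left to
right. -/
noncomputable def antitoneSort {n : ℕ} (f : Fin n → ℕ) : Equiv.Perm (Fin n) :=
  Tuple.sort fun i => OrderDual.toDual (f i)

/-- Two letters change places when a word is sorted exactly if the later one is larger. -/
lemma antitoneSort_symm_lt_iff {n : ℕ} (f : Fin n → ℕ) {a b : Fin n} (hab : a < b) :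
    (antitoneSort f)⁻¹ b < (antitoneSort f)⁻¹ a ↔ f a < f b := by
  obtain ⟨h1, h2⟩ := Tuple.eq_sort_iff.mp (rfl : antitoneSort f = _)
  set π := antitoneSort f
  constructor
  · intro h
    have h3 : f (π (π⁻¹ a)) ≤ f (π (π⁻¹ b)) := h1 h.le
    have h4 := h2 _ _ h
    simp only [← Equiv.Perm.mul_apply, mul_inv_cancel, Equiv.Perm.one_apply] at h3 h4
    refine lt_of_le_of_ne h3 fun h5 => ?_
    exact absurd (h4 (congrArg _ h5.symm)) hab.not_gt
  · intro h
    by_contra! h3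
    have h4 : f (π (π⁻¹ b)) ≤ f (π (π⁻¹ a)) := h1 h3
    simp only [← Equiv.Perm.mul_apply, mul_inv_cancel, Equiv.Perm.one_apply] at h4
    omega

lemma descentSet_antitoneSort_inv {n : ℕ} (f : Fin n → ℕ) :
    descentSet (antitoneSort f)⁻¹ = ascentSet f := by
  refine filter_congr fun i _ => exists₂_congr fun a b => ?_
  refine and_congr_right fun h1 => and_congr_right fun h2 => ?_
  exact antitoneSort_symm_lt_iff f (Fin.lt_def.mpr (by omega))

/-- A permutation `π` sorts `f` exactly if `f ∘ π` is weakly decreasing, strictly so at the descents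
of `π`. -/
lemma antitoneSort_eq_iff {n : ℕ} (f : Fin (n + 1) → ℕ) (π : Equiv.Perm (Fin (n + 1))) :
    antitoneSort f = π ↔ ∀ i : Fin n,
      f (π i.succ) + (if π i.succ < π i.castSucc then 1 else 0) ≤ f (π i.castSucc) := by
  rw [eq_comm, antitoneSort, Tuple.eq_sort_iff', Fin.strictMono_iff_lt_succ]
  refine forall_congr' fun i => ?_
  have hne : π i.succ ≠ π i.castSucc := fun h => (Fin.castSucc_lt_succ (i := i)).ne' (π.injective h)
  rw [← Subtype.coe_lt_coe]
  change toLex (OrderDual.toDual (f (π i.castSucc)), π i.castSucc) <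
    toLex (OrderDual.toDual (f (π i.succ)), π i.succ) ↔ _
  rw [Prod.Lex.toLex_lt_toLex]
  simp only [OrderDual.toDual_lt_toDual, OrderDual.toDual_inj]
  split_ifs with h
  · have := h.not_gt
    simp only [this, and_false, or_false]
    omega
  · have : π i.castSucc < π i.succ := lt_of_le_of_ne (not_lt.mp h) hne.symm
    simp only [this, and_true]
    omega

lemma tsum_ite_le_pow_mul (x : ℝ≥0∞) (c k : ℕ) :
    ∑' a : ℕ, (if k ≤ a then x ^ (c * a) else 0) = x ^ (c * k) * (1 - x ^ c)⁻¹ := by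
  rw [← ENNReal.tsum_geometric, ← ENNReal.tsum_mul_left,
    ← (add_left_injective k).tsum_eq (f := fun a => if k ≤ a then x ^ (c * a) else 0)]
  · refine tsum_congr fun a => ?_
    simp only [le_add_iff_nonneg_left, zero_le, if_true, ← pow_mul, ← pow_add]
    congr 1; ring
  · intro a ha
    simp only [Function.mem_support, ne_eq, ite_eq_right_iff, not_forall] at ha
    exact ⟨a - k, Nat.sub_add_cancel ha.1⟩

/-- The generating function of the words that decrease by at least `δ i` at the `i`-th step. The
first letter is counted with multiplicity `c`: summing it out leaves a word of the same kind whose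
first letter has multiplicity `c + 1`. -/
lemma tsum_decreasing (x : ℝ≥0∞) (n c : ℕ) (δ : ℕ → ℕ) :
    ∑' g : Fin (n + 1) → ℕ, (if ∀ i : Fin n, g i.succ + δ i ≤ g i.castSucc then
      x ^ (c * g 0 + ∑ i : Fin n, g i.succ) else 0) =
    x ^ (∑ i ∈ range n, (c + i) * δ i) * ∏ i ∈ range (n + 1), (1 - x ^ (c + i))⁻¹ := by
  induction n generalizing c δ with
  | zero =>
    rw [← (Equiv.funUnique (Fin 1) ℕ).symm.tsum_eq]
    simp [pow_mul, ENNReal.tsum_geometric]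
  | succ n ih =>
    rw [← (Fin.consEquiv fun _ => ℕ).tsum_eq, ENNReal.tsum_prod', ENNReal.tsum_comm]
    have key (g : Fin (n + 1) → ℕ) :
        ∑' a : ℕ, (if ∀ i : Fin (n + 1), (Fin.cons a g : Fin (n + 2) → ℕ) i.succ + δ i ≤
            (Fin.cons a g : Fin (n + 2) → ℕ) i.castSucc then
          x ^ (c * (Fin.cons a g : Fin (n + 2) → ℕ) 0 +
            ∑ i : Fin (n + 1), (Fin.cons a g : Fin (n + 2) → ℕ) i.succ) else 0) =
        x ^ (c * δ 0) * (1 - x ^ c)⁻¹ *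
          if ∀ i : Fin n, g i.succ + δ (i + 1) ≤ g i.castSucc then
            x ^ ((c + 1) * g 0 + ∑ i : Fin n, g i.succ) else 0 := by
      simp only [Fin.forall_fin_succ, Fin.cons_succ, Fin.cons_zero, Fin.castSucc_zero,
        ← Fin.succ_castSucc, Fin.val_zero, Fin.val_succ, pow_add x (c * _)]
      by_cases hg : ∀ i : Fin n, g i.succ + δ (i + 1) ≤ g i.castSucc
      · simp only [hg, implies_true, and_true, if_true]
        simp_rw [← ite_zero_mul]
        rw [ENNReal.tsum_mul_right, tsum_ite_le_pow_mul, Fin.sum_univ_succ]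
        simp only [mul_add, add_mul, pow_add]
        ring
      · simp [hg]
    refine (tsum_congr key).trans ?_
    rw [ENNReal.tsum_mul_left, ih (c + 1) fun i => δ (i + 1), sum_range_succ',
      prod_range_succ' _ (n + 1)]
    simp only [add_zero, pow_add, add_assoc, add_comm 1]
    ring

lemma majorIndex_eq {n : ℕ} (π : Equiv.Perm (Fin (n + 1))) (δ : ℕ → ℕ)
    (hδ : ∀ i : Fin n, δ i = if π i.succ < π i.castSucc then 1 else 0) :
    majorIndex π = ∑ i ∈ range n, (1 + i) * δ i := by
  rw [majorIndex, descentSet, sum_filter, sum_Ico_eq_sum_range]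
  refine sum_congr (by simp) fun i hi => ?_
  have hi : i < n := by simpa using hi
  rw [hδ ⟨i, hi⟩, mul_ite, mul_one, mul_zero]
  refine if_congr ⟨?_, fun h => ?_⟩ rfl rfl
  · rintro ⟨a, b, ha, hb, h⟩
    obtain rfl : a = (⟨i, hi⟩ : Fin n).castSucc := Fin.ext (by simp; omega)
    obtain rfl : b = (⟨i, hi⟩ : Fin n).succ := Fin.ext (by simp; omega)
    exact h
  · exact ⟨_, _, by simp [add_comm], by simp [add_comm], h⟩

/-- The words with a given sorting permutation `π` have generating function
`x ^ maj(π) / ((1 - x) (1 - x ^ 2) ⋯)`. -/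
lemma tsum_antitoneSort_eq {n : ℕ} (π : Equiv.Perm (Fin (n + 1))) (x : ℝ≥0∞) :
    ∑' f : Fin (n + 1) → ℕ, (if antitoneSort f = π then x ^ ∑ i, f i else 0) =
      x ^ majorIndex π * ∏ i ∈ range (n + 1), (1 - x ^ (i + 1))⁻¹ := by
  let δ : ℕ → ℕ := fun i => if h : i < n then
    (if π (Fin.succ ⟨i, h⟩) < π (Fin.castSucc ⟨i, h⟩) then 1 else 0) else 0
  have hδ (i : Fin n) : δ i = if π i.succ < π i.castSucc then 1 else 0 := dif_pos i.2
  rw [majorIndex_eq π δ hδ]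
  have := tsum_decreasing x n 1 δ
  simp only [add_comm 1] at this ⊢
  rw [← this, ← (π.arrowCongr (Equiv.refl ℕ)).tsum_eq]
  refine tsum_congr fun g => ?_
  refine if_congr ?_ ?_ rfl
  · rw [antitoneSort_eq_iff]
    simp [Equiv.arrowCongr, hδ]
  · congr 1
    rw [one_mul, ← Fin.sum_univ_succ]
    simpa [Equiv.arrowCongr] using Equiv.sum_comp π.symm g

/-- The word `f` is counted at the inverse of its sorting permutation, whose descents are the
ascents of `f`. -/
lemma ascentSeries_eq (n : ℕ) (S : Finset ℕ) (x : ℝ≥0∞) :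
    ascentSeries (n + 1) S x =
      descentSum (n + 1) S x * ∏ i ∈ range (n + 1), (1 - x ^ (i + 1))⁻¹ := by
  rw [descentSum, sum_mul]
  simp_rw [← tsum_antitoneSort_eq]
  rw [← Summable.tsum_finsetSum fun _ _ => ENNReal.summable]
  refine tsum_congr fun f => ?_
  simp only [← inv_eq_iff_eq_inv, sum_ite_eq, mem_filter, mem_univ, true_and,
    descentSet_antitoneSort_inv]

lemma mem_ascentSet_append {a b : ℕ} (u : Fin a → ℕ) (v : Fin b → ℕ) {i : ℕ} (hi : i ≠ a) :
    i ∈ ascentSet (Fin.append u v) ↔ i ∈ ascentSet u ∨ ∃ j ∈ ascentSet v, a + j = i := by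
  simp only [ascentSet, mem_filter, mem_Ico]
  constructor
  · rintro ⟨hi1, c, d, hc, hd, h⟩
    induction c using Fin.addCases with
    | left c =>
      induction d using Fin.addCases with
      | left d =>
        simp only [Fin.val_castAdd, Fin.append_left] at hc hd h
        exact Or.inl ⟨by omega, c, d, hc, hd, h⟩
      | right d =>
        simp only [Fin.val_castAdd, Fin.val_natAdd] at hc hd
        omega
    | right c =>
      induction d using Fin.addCases with
      | left d =>
        simp only [Fin.val_castAdd, Fin.val_natAdd] at hc hd
        omega
      | right d =>
        simp only [Fin.val_natAdd, Fin.append_right] at hc hd h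
        exact Or.inr ⟨d, ⟨by omega, c, d, by omega, rfl, h⟩, hd⟩
  · rintro (⟨hi1, c, d, hc, hd, h⟩ | ⟨j, ⟨hj, c, d, hc, hd, h⟩, rfl⟩)
    · exact ⟨by omega, Fin.castAdd b c, Fin.castAdd b d, hc, hd, by simpa using h⟩
    · exact ⟨by omega, Fin.natAdd a c, Fin.natAdd a d, by simp; omega, by simp; omega,
        by simpa using h⟩

/-- A weakly decreasing word followed by a word with ascent set `S`, according to whether an
ascent arises at the junction. -/
lemma ascentSet_append_iff {a b : ℕ} (u : Fin a → ℕ) (v : Fin b → ℕ) {S : Finset ℕ} (hS : 0 ∉ S) :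
    (ascentSet u = ∅ ∧ ascentSet v = S) ↔
      ascentSet (Fin.append u v) = S.map (addLeftEmbedding a) ∨
      ascentSet (Fin.append u v) = insert a (S.map (addLeftEmbedding a)) := by
  have hu : ∀ i ∈ ascentSet u, i < a := fun i hi => by
    simp only [ascentSet, mem_filter, mem_Ico] at hi; omega
  have hv : ∀ i ∈ ascentSet v, 0 < i := fun i hi => by
    simp only [ascentSet, mem_filter, mem_Ico] at hi; omega
  have hS' : ∀ i ∈ S, 0 < i := fun i hi => Nat.pos_of_ne_zero fun h => hS (h ▸ hi)
  -- only the junction `a` is left undetermined by `u` and `v`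
  have key : (ascentSet u = ∅ ∧ ascentSet v = S) ↔ ∀ i ≠ a,
      (i ∈ ascentSet (Fin.append u v) ↔ i ∈ S.map (addLeftEmbedding a)) := by
    constructor
    · rintro ⟨h1, h2⟩ i hi
      rw [mem_ascentSet_append u v hi, h1, h2]
      simp
    · intro h
      have h' : ∀ i ≠ a, (i ∈ ascentSet u ∨ ∃ j ∈ ascentSet v, a + j = i) ↔
          ∃ j ∈ S, a + j = i := fun i hi => by
        rw [← mem_ascentSet_append u v hi, h i hi]; simp
      refine ⟨eq_empty_of_forall_notMem fun i hi => ?_, ?_⟩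
      · obtain ⟨j, -, hj⟩ := (h' i (hu i hi).ne).mp (Or.inl hi)
        have := hu i hi
        omega
      · ext j
        constructor
        · intro hj
          have := hv j hj
          obtain ⟨k, hk, hkj⟩ := (h' (a + j) (by omega)).mp (Or.inr ⟨j, hj, rfl⟩)
          obtain rfl : k = j := by omega
          exact hk
        · intro hj
          have := hS' j hj
          rcases (h' (a + j) (by omega)).mpr ⟨j, hj, rfl⟩ with h1 | ⟨k, hk, hkj⟩
          · have := hu _ h1
            omega
          · obtain rfl : k = j := by omega
            exact hk
  have ha : a ∉ S.map (addLeftEmbedding a) := by simpa using hS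
  rw [key]
  constructor
  · intro h
    by_cases hm : a ∈ ascentSet (Fin.append u v)
    · right
      ext i
      by_cases hi : i = a
      · simp [hi, hm]
      · rw [h i hi, mem_insert, or_iff_right hi]
    · left
      ext i
      by_cases hi : i = a
      · subst hi; exact iff_of_false hm ha
      · exact h i hi
  · rintro (h | h) i hi
    · rw [h]
    · rw [h, mem_insert, or_iff_right hi]

lemma ascentSeries_mul (a b : ℕ) {S : Finset ℕ} (hS : 0 ∉ S) (x : ℝ≥0∞) :
    ascentSeries a ∅ x * ascentSeries b S x =
      ascentSeries (a + b) (S.map (addLeftEmbedding a)) x +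
        ascentSeries (a + b) (insert a (S.map (addLeftEmbedding a))) x := by
  have hne : S.map (addLeftEmbedding a) ≠ insert a (S.map (addLeftEmbedding a)) := fun h => by
    have : a ∈ S.map (addLeftEmbedding a) := h ▸ mem_insert_self _ _
    simp [hS] at this
  simp only [ascentSeries]
  rw [← ENNReal.tsum_add, ← (Fin.appendEquiv a b).tsum_eq, ENNReal.tsum_prod',
    ← ENNReal.tsum_mul_right]
  refine tsum_congr fun u => ?_
  rw [← ENNReal.tsum_mul_left]
  refine tsum_congr fun v => ?_
  have h := ascentSet_append_iff u v hS
  simp only [Fin.appendEquiv, Equiv.coe_fn_mk]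
  rw [ite_zero_mul_ite_zero, ← pow_add, if_congr h rfl rfl, Fin.sum_univ_add]
  simp only [Fin.append_left, Fin.append_right]
  by_cases h1 : ascentSet (Fin.append u v) = S.map (addLeftEmbedding a)
  · simp [h1, hne]
  · simp [h1]

end PPartition

/-! ### The product formula for descent classes -/

lemma map_descentSum {R R' : Type*} [CommSemiring R] [CommSemiring R'] (φ : R →+* R') (n : ℕ)
    (S : Finset ℕ) (q : R) : φ (descentSum n S q) = descentSum n S (φ q) := by
  simp [descentSum]

lemma map_qFactorial {R R' : Type*} [CommSemiring R] [CommSemiring R'] (φ : R →+* R') (n : ℕ)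
    (q : R) : φ (qFactorial q n) = qFactorial (φ q) n := by
  simp [qFactorial, qInt]

lemma descentSum_empty {R : Type*} [CommSemiring R] (n : ℕ) (q : R) : descentSum n ∅ q = 1 := by
  have h : ({σ | descentSet σ = ∅} : Finset (Equiv.Perm (Fin n))) = {1} := by
    ext σ
    simp only [mem_filter, mem_univ, true_and, mem_singleton]
    constructor
    · intro h
      -- a monotone permutation is the identity
      rw [← Equiv.Perm.monotone_iff]
      cases n with
      | zero => exact Subsingleton.monotone _
      | succ n =>
        refine Fin.monotone_iff_le_succ.mpr fun i => not_lt.mp fun hi => ?_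
        have : (i : ℕ) + 1 ∈ descentSet σ := by
          simp only [descentSet, mem_filter, mem_Ico]
          exact ⟨by omega, i.castSucc, i.succ, by simp, by simp, hi⟩
        simp [h] at this
    · rintro rfl
      refine filter_eq_empty_iff.mpr ?_
      rintro i - ⟨a, b, ha, hb, h⟩
      simp only [Equiv.Perm.one_apply, Fin.lt_def] at h
      omega
  have h1 : descentSet (1 : Equiv.Perm (Fin n)) = ∅ := by
    have : (1 : Equiv.Perm (Fin n)) ∈ ({1} : Finset _) := mem_singleton_self _
    rw [← h] at this
    simpa using this
  simp [descentSum, h, majorIndex, h1]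

lemma prod_one_sub_pow {R : Type*} [CommRing R] (q : R) (n : ℕ) :
    ∏ i ∈ range n, (1 - q ^ (i + 1)) = (1 - q) ^ n * qFactorial q n := by
  simp only [qFactorial, qInt, ← mul_neg_geom_sum, prod_mul_distrib, prod_const, card_range]

/-- The product formula at a real number between `0` and `1`, where it compares convergent
generating functions. -/
lemma descentSum_mul_qFactorial_real {a b : ℕ} (ha : a ≠ 0) (hb : b ≠ 0) {S : Finset ℕ}
    (hS : 0 ∉ S) {r : ℝ} (h0 : 0 < r) (h1 : r < 1) :
    descentSum b S r * qFactorial r (a + b) =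
      (descentSum (a + b) (S.map (addLeftEmbedding a)) r +
        descentSum (a + b) (insert a (S.map (addLeftEmbedding a))) r) *
      (qFactorial r a * qFactorial r b) := by
  have hP (n : ℕ) : (∏ i ∈ range n, (1 - ENNReal.ofReal r ^ (i + 1))⁻¹).toReal =
      ((1 - r) ^ n * qFactorial r n)⁻¹ := by
    rw [ENNReal.toReal_prod, ← prod_one_sub_pow, ← prod_inv_distrib]
    refine prod_congr rfl fun i _ => ?_
    rw [ENNReal.toReal_inv, ENNReal.toReal_sub_of_le (pow_le_one₀ (by simp) (by simpa using h1.le))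
      (by simp), ENNReal.toReal_pow, ENNReal.toReal_ofReal h0.le, ENNReal.toReal_one]
  have hD (n : ℕ) (T : Finset ℕ) : (descentSum n T (ENNReal.ofReal r)).toReal =
      descentSum n T r := by
    rw [descentSum, ENNReal.toReal_sum (by simp), descentSum]
    simp [ENNReal.toReal_ofReal h0.le]
  have hDtop (n : ℕ) (T : Finset ℕ) : descentSum n T (ENNReal.ofReal r) ≠ ⊤ := by
    simp [descentSum]
  have hU (n : ℕ) (hn : n ≠ 0) (T : Finset ℕ) :
      ascentSeries n T (ENNReal.ofReal r) = descentSum n T (ENNReal.ofReal r) *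
        ∏ i ∈ range n, (1 - ENNReal.ofReal r ^ (i + 1))⁻¹ := by
    obtain ⟨n, rfl⟩ := Nat.exists_eq_succ_of_ne_zero hn
    exact ascentSeries_eq n T _
  have hF (n : ℕ) : qFactorial r n ≠ 0 := by
    refine (prod_pos fun i _ => ?_).ne'
    exact sum_pos (fun j _ => pow_pos h0 j) (by simp)
  have key := congrArg ENNReal.toReal (ascentSeries_mul a b hS (ENNReal.ofReal r))
  rw [hU a ha, hU b hb, hU (a + b) (by omega), hU (a + b) (by omega), descentSum_empty, one_mul,
    ← add_mul] at key
  simp only [ENNReal.toReal_mul, hP, ENNReal.toReal_add (hDtop _ _) (hDtop _ _), hD] at key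
  rw [pow_add (1 - r)] at key
  have hr : 1 - r ≠ 0 := by linarith
  have hFa := hF a
  have hFb := hF b
  have hFab := hF (a + b)
  field_simp at key
  linear_combination key

/-- The product formula. The permutations of `a + b` letters that increase on the first `a`
positions and whose descents beyond position `a` are at `S`, shifted by `a`, may or may not have a
descent at `a`. Weighted by `q ^ maj(σ⁻¹)`, their sum is the `q`-binomial coefficient
`[a + b]! / ([a]! [b]!)` times that of the permutations of `b` letters with descent set `S`. -/
lemma descentSum_mul_qFactorial {R : Type*} [CommRing R] (q : R) {a b : ℕ} (ha : a ≠ 0)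
    (hb : b ≠ 0) {S : Finset ℕ} (hS : 0 ∉ S) :
    descentSum b S q * qFactorial q (a + b) =
      (descentSum (a + b) (S.map (addLeftEmbedding a)) q +
        descentSum (a + b) (insert a (S.map (addLeftEmbedding a))) q) *
      (qFactorial q a * qFactorial q b) := by
  -- a polynomial identity over `ℝ` holds if it holds on `(0, 1)`; its coefficients are integers
  have hreal : descentSum b S (Polynomial.X : Polynomial ℝ) * qFactorial Polynomial.X (a + b) =
      (descentSum (a + b) (S.map (addLeftEmbedding a)) Polynomial.X +
        descentSum (a + b) (insert a (S.map (addLeftEmbedding a))) Polynomial.X) *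
      (qFactorial Polynomial.X a * qFactorial Polynomial.X b) := by
    refine Polynomial.eq_of_infinite_eval_eq _ _ ((Set.Ioo_infinite one_pos).mono ?_)
    rintro r ⟨h0, h1⟩
    simp only [Set.mem_ofPred_eq, ← Polynomial.coe_evalRingHom, map_mul, map_add, map_descentSum,
      map_qFactorial]
    simpa using descentSum_mul_qFactorial_real ha hb hS h0 h1
  have hint : descentSum b S (Polynomial.X : Polynomial ℤ) * qFactorial Polynomial.X (a + b) =
      (descentSum (a + b) (S.map (addLeftEmbedding a)) Polynomial.X +
        descentSum (a + b) (insert a (S.map (addLeftEmbedding a))) Polynomial.X) *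
      (qFactorial Polynomial.X a * qFactorial Polynomial.X b) := by
    apply Polynomial.map_injective (Int.castRingHom ℝ) Int.cast_injective
    simp only [← Polynomial.coe_mapRingHom, map_mul, map_add, map_descentSum, map_qFactorial]
    simpa using hreal
  have := congrArg (Polynomial.eval₂RingHom (Int.castRingHom R) q) hint
  simp only [map_mul, map_add, map_descentSum, map_qFactorial] at this
  simpa using this

/-! ### `q`-Euler numbers as a `q`-tangent -/

/-- The even positions from `2 k` to `2 n`. -/
def evenTail (n k : ℕ) : Finset ℕ := {i ∈ Ico 1 (2 * n + 1) | Even i ∧ 2 * k ≤ i}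

lemma qEulerNumber_eq_descentSum {K : Type*} [CommSemiring K] (n : ℕ) (q : K) :
    qEulerNumber (2 * n + 1) q = descentSum (2 * n + 1) (evenTail n 1) q := by
  rw [qEulerNumber, RevAlt, descentSum]
  congr! 3
  ext i
  simp only [evenTail, mem_filter, mem_Ico]
  refine and_congr_right fun h => ⟨fun h' => ⟨h', ?_⟩, And.left⟩
  obtain ⟨k, rfl⟩ := h'
  omega

lemma insert_evenTail {n k : ℕ} (h0 : k ≠ 0) (hk : k ≤ n) :
    insert (2 * k) (evenTail n (k + 1)) = evenTail n k := by
  ext i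
  simp only [evenTail, mem_insert, mem_filter, mem_Ico, Nat.even_iff]
  omega

lemma map_evenTail (m k : ℕ) :
    (evenTail m 1).map (addLeftEmbedding (2 * k)) = evenTail (k + m) (k + 1) := by
  ext i
  simp only [evenTail, mem_map, mem_filter, mem_Ico, Nat.even_iff, addLeftEmbedding_apply]
  constructor
  · rintro ⟨j, hj, rfl⟩
    omega
  · intro h
    exact ⟨i - 2 * k, by omega, by omega⟩

lemma evenTail_succ_self (n : ℕ) : evenTail n (n + 1) = ∅ := by
  refine filter_eq_empty_iff.mpr fun i hi => ?_
  simp only [mem_Ico] at hi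
  omega

lemma zero_notMem_evenTail (n k : ℕ) : 0 ∉ evenTail n k := by simp [evenTail]

section EulerSeries

open PowerSeries DyckWord

variable {K : Type*} [Field K]

/-- The generating function of the `q`-Euler numbers of odd index, with `X` for the square of the
variable. As for `besselSeries`, only coefficients with nonzero denominators are used. -/
def eulerSeries (q : K) : PowerSeries K :=
  PowerSeries.mk fun n => qEulerNumber (2 * n + 1) q / qFactorial q (2 * n + 1)

/-- A permutation that increases on the first `2 k` positions and is reverse alternating beyond
either has a descent at `2 k` or not, so that the alternating sum over `k` telescopes. -/
lemma sum_eulerNumber_telescope {q : K} {n : ℕ} (hq : ∀ k ∈ Icc 1 (2 * n + 1), qInt q k ≠ 0)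
    {k : ℕ} (hk : k ≤ n) :
    ∑ j ∈ range (k + 1), (-1) ^ j / qFactorial q (2 * j) *
        (qEulerNumber (2 * (n - j) + 1) q / qFactorial q (2 * (n - j) + 1)) =
      (-1) ^ k * descentSum (2 * n + 1) (evenTail n (k + 1)) q / qFactorial q (2 * n + 1) := by
  induction k with
  | zero => simp [qEulerNumber_eq_descentSum, qFactorial]
  | succ k ih =>
    rw [sum_range_succ, ih (by omega)]
    obtain ⟨m, rfl⟩ := Nat.exists_eq_add_of_le hk
    have key := descentSum_mul_qFactorial q (a := 2 * (k + 1)) (b := 2 * m + 1) (by omega)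
      (by omega) (zero_notMem_evenTail m 1)
    rw [map_evenTail, insert_evenTail (by omega) (by omega), ← qEulerNumber_eq_descentSum,
      show 2 * (k + 1) + (2 * m + 1) = 2 * (k + 1 + m) + 1 by ring] at key
    rw [Nat.add_sub_cancel_left]
    have h1 := qFactorial_ne_zero hq (k := 2 * (k + 1)) (by omega)
    have h2 := qFactorial_ne_zero hq (k := 2 * m + 1) (by omega)
    have h3 := qFactorial_ne_zero hq le_rfl
    rw [div_mul_div_comm, div_add_div _ _ h3 (mul_ne_zero h1 h2),
      div_eq_div_iff (mul_ne_zero h3 (mul_ne_zero h1 h2)) h3]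
    linear_combination ((-1) ^ (k + 1) * qFactorial q (2 * (k + 1 + m) + 1)) * key

/-- The generating function of the `q`-Euler numbers of odd index is a `q`-tangent. -/
lemma X_pow_dvd_eulerSeries_mul_sub {q : K} {N : ℕ}
    (hq : ∀ k ∈ Icc 1 (2 * N + 1), qInt q k ≠ 0) :
    X ^ (N + 1) ∣ eulerSeries q * besselSeries q 0 - besselSeries q 1 := by
  rw [X_pow_dvd_iff]
  intro n hn
  have h := sum_eulerNumber_telescope (q := q) (n := n)
    (fun k hk => hq k (by simp only [mem_Icc] at *; omega)) le_rfl
  rw [map_sub, mul_comm, PowerSeries.coeff_mul, Nat.sum_antidiagonal_eq_sum_range_succ_mk]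
  simp only [besselSeries, eulerSeries, coeff_mk, besselDenom_zero_left, besselDenom_one_left]
  rw [h, evenTail_succ_self, descentSum_empty, mul_one, sub_self]

/-- The Dyck path formula, with weights normalised so that `q = 1` is allowed. -/
theorem sum_prod_dyckWeight {q : K} {n : ℕ} (hq : ∀ k ∈ Icc 1 (2 * n + 1), qInt q k ≠ 0) :
    ∑ d : {d : DyckWord // d.semilength = n},
        ∏ i ∈ range (2 * n + 1), dyckWeight q (d.1.height i) =
      qEulerNumber (2 * n + 1) q / qFactorial q (2 * n + 1) := by
  rw [sum_prod_height]
  have h1 := X_pow_dvd_dyckSeries_mul_sub hq (h := 0) (m := n + 1) (by omega)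
  have h2 := dvd_sub h1 (X_pow_dvd_eulerSeries_mul_sub hq)
  have hunit : IsUnit (besselSeries q 0) := by
    rw [PowerSeries.isUnit_iff_constantCoeff]
    simp [besselSeries, besselDenom, ← PowerSeries.coeff_zero_eq_constantCoeff_apply]
  have h3 : X ^ (n + 1) ∣ (dyckSeries q 0 - eulerSeries q) * besselSeries q 0 := by
    convert h2 using 1
    simp only [pow_zero, map_one, one_mul, zero_add]
    ring
  -- `besselSeries q 0` has constant term `1`, so it cancels even modulo a power of `X`
  have h4 := X_pow_dvd_iff.mp (hunit.dvd_mul_right.mp h3) n (by omega)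
  simpa [dyckSeries, eulerSeries, sub_eq_zero] using h4

end EulerSeries

/-! ### Alternating and reverse alternating permutations -/

lemma descentSet_trans_revPerm {n : ℕ} (σ : Equiv.Perm (Fin n)) :
    descentSet (σ.trans Fin.revPerm) = Ico 1 n \ descentSet σ := by
  ext i
  simp only [descentSet, mem_sdiff, mem_filter, not_and, not_exists]
  refine and_congr_right fun hi => ?_
  constructor
  · rintro ⟨a, b, ha, hb, h⟩ - a' b' ha' hb'
    obtain rfl : a' = a := Fin.ext (by omega)
    obtain rfl : b' = b := Fin.ext (by omega)
    simp only [Equiv.trans_apply, Fin.revPerm_apply, Fin.rev_lt_rev] at h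
    exact h.not_gt
  · intro h
    have hi' := mem_Ico.mp hi
    refine ⟨⟨i - 1, by omega⟩, ⟨i, by omega⟩, by simp; omega, rfl, ?_⟩
    have h1 := h hi ⟨i - 1, by omega⟩ ⟨i, by omega⟩ (by simp; omega) rfl
    simp only [Equiv.trans_apply, Fin.revPerm_apply, Fin.rev_lt_rev]
    refine lt_of_le_of_ne (not_lt.mp h1) fun h2 => ?_
    have := congrArg Fin.val (σ.injective h2)
    simp only at this
    omega

/-- Replacing each value `i` by `n + 1 - i` exchanges ascents and descents. -/
lemma card_Alt_eq_card_RevAlt (n : ℕ) : (Alt n).card = (RevAlt n).card := by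
  have hr (σ : Equiv.Perm (Fin n)) : (σ.trans Fin.revPerm).trans Fin.revPerm = σ := by
    ext; simp
  refine card_nbij' (fun σ => σ.trans Fin.revPerm) (fun σ => σ.trans Fin.revPerm) ?_ ?_
    (fun σ _ => hr σ) (fun σ _ => hr σ)
  · intro σ hσ
    simp only [Alt, RevAlt, mem_coe, mem_filter, mem_univ, true_and] at *
    rw [descentSet_trans_revPerm, hσ]
    ext i
    simp only [mem_sdiff, mem_filter, ← Nat.not_even_iff_odd]
    tauto
  · intro σ hσ
    simp only [Alt, RevAlt, mem_coe, mem_filter, mem_univ, true_and] at *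
    rw [descentSet_trans_revPerm, hσ]
    ext i
    simp only [mem_sdiff, mem_filter, ← Nat.not_even_iff_odd]
    tauto

/-! ### The Dyck path formulas -/

theorem mainTheorem1 (n : ℕ) :
    (∀ (K : Type*) [Field K] (q : K), (∀ k ∈ Finset.Icc 1 (2 * n + 1), q ^ k ≠ 1) →
      ∑ d : {d : DyckWord // d.semilength = n},
          ∏ i ∈ Finset.range (2 * n + 1),
            q ^ d.1.height i / (1 - q ^ (2 * d.1.height i + 1)) =
        qEulerNumber (2 * n + 1) q / qPochhammer q q (2 * n + 1)) ∧
    ∑ d : {d : DyckWord // d.semilength = n},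
        ((2 * n + 1).factorial : ℚ) /
          ∏ i ∈ Finset.range (2 * n + 1), (2 * (d.1.height i : ℚ) + 1) =
      (eulerNumber (2 * n + 1) : ℚ) := by
  constructor
  · intro K _ q hq
    have hq' : ∀ k ∈ Icc 1 (2 * n + 1), qInt q k ≠ 0 := fun k hk h => hq k hk <| by
      have := mul_neg_geom_sum q k
      rw [← qInt, h, mul_zero] at this
      exact (sub_eq_zero.mp this.symm).symm
    have hP : qPochhammer q q (2 * n + 1) =
        (1 - q) ^ (2 * n + 1) * qFactorial q (2 * n + 1) := by
      rw [← prod_one_sub_pow, qPochhammer]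
      simp only [pow_succ']
    rw [hP, mul_comm ((1 - q) ^ _), ← div_div, ← sum_prod_dyckWeight hq', sum_div]
    refine sum_congr rfl fun d _ => ?_
    simp only [dyckWeight, qInt, ← mul_neg_geom_sum, prod_div_distrib, prod_mul_distrib,
      prod_const, card_range, div_div, mul_comm]
  · have hint (k : ℕ) : qInt (1 : ℚ) k = k := by simp [qInt]
    have hfac (k : ℕ) : qFactorial (1 : ℚ) k = k.factorial := by
      simp [qFactorial, hint, ← prod_range_add_one_eq_factorial]
    have h := sum_prod_dyckWeight (q := (1 : ℚ)) (n := n) fun k hk => by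
      rw [hint, Nat.cast_ne_zero]
      have := mem_Icc.mp hk
      omega
    have hE : qEulerNumber (2 * n + 1) (1 : ℚ) = eulerNumber (2 * n + 1) := by
      simp [qEulerNumber, eulerNumber, card_Alt_eq_card_RevAlt]
    rw [hfac, hE, eq_div_iff (by positivity), sum_mul] at h
    rw [← h]
    refine sum_congr rfl fun d _ => ?_
    simp [dyckWeight, hint, div_eq_mul_inv, mul_comm]
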